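/- Theorem (thermodynamic limit for the GREM with infinitely many levels). Let $(\alpha_i)_{i\ge1}$ be real numbers with $\alpha_i>1$ and $\sum_{i\ge1}\log\alpha_i=\log 2$ (H1), let $(a_i)_{i\ge1}$ be positive real numbers with $\sum_{i\ge1}a_i=1$ (H2), and let $\beta>0$. For $N\in\mathbb N$ put $k_i(N)=\lfloor N\log\alpha_i/\log 2\rfloor$; only finitely many of these are non-zero. Let $n(N)=\max\{i: k_i(N)>0\}$ (and $n(N)=0$ if there is no such $i$), $\underline k(N)=(k_1(N),\dots,k_{n(N)}(N))$ and $|\underline k(N)|=\sum_i k_i(N)$. Let $\mathcal T_{\underline k(N)}$ be the rooted tree in which every node at level $i-1$ has $2^{k_i(N)}$ children at level $i$, $1\le i\le n(N)$, where for $k_i(N)=0$ the nodes of level $i$ coincide with those of level $i-1$ and there are no edges between the two levels. Its $2^{|\underline k(N)|}$ leaves are labelled by the spin configurations $\sigma\in\{-1,1\}^{|\underline k(N)|}$: each edge leading to level $i$ fixes the values of the $k_i(N)$ spins with indices $m\in\{\sum_{j<i}k_j(N)+1,\dots,\sum_{j\le i}k_j(N)\}$, the edges from a common parent carrying the $2^{k_i(N)}$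 different sign patterns. Attach to the edges independent centred Gaussian variables, those on edges between levels $i-1$ and $i$ having variance $a_i$. Let $\varepsilon_i^{(\sigma)}$ be the variable on the edge between levels $i-1$ and $i$ of the path from the root to the leaf $\sigma$, with $\varepsilon_i^{(\sigma)}=0$ if $k_i(N)=0$, and set $$H_N(\sigma)=-\sqrt{|\underline k(N)|}\,\sum_{i=1}^{n(N)}\varepsilon_i^{(\sigma)},\qquad Z_N(\beta)=\sum_{\sigma}e^{-\beta H_N(\sigma)},\qquad A_N(\beta)=-\mathbb E[\log Z_N(\beta)].$$ Then $\log Z_N(\beta)$ is integrable for every $N$, and the quenched free energy density converges to a finite limit, which is an infimum: $$-\infty<\lim_{N\to\infty}-\frac{1}{\beta|\underline k(N)|}\,\mathbb E[\log Z_N(\beta)]=\inf_{N\ge1}\frac{A_N(\beta)}{\beta N}<\infty .$$ -/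

import Mathlib

open MeasureTheory ProbabilityTheory Filter Topology

noncomputable section

namespace GREM

/-- The total number of spins `|k| = k₁ + ⋯ + kₙ` (levels are indexed from `0`, so that
`i : Fin n` stands for the level `i + 1`). -/
abbrev size {n : ℕ} (k : Fin n → ℕ) : ℕ := ∑ i, k i

/-- Spin configurations `σ ∈ {-1, 1}^|k|`; they label the leaves of the tree `T_k`. -/
abbrev Config {n : ℕ} (k : Fin n → ℕ) : Type := Fin (size k) → ℤˣ

/-- The nodes of the tree `T_k` at level `i`. The edges from a node to its `2 ^ k j` children at
the next level `j` carry the `2 ^ k j` sign patterns of the `k j` spins of level `j`, so a node at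
level `i` is given by the signs of all the spins of the levels `j ≤ i`. -/
abbrev Node {n : ℕ} (k : Fin n → ℕ) (i : Fin n) : Type :=
  (j : {j : Fin n // j ≤ i}) → Fin (k j) → ℤˣ

/-- The edges of the tree `T_k`: at each level `i` with `k i > 0` there is exactly one edge from
the previous level to each node of level `i`; there are no edges at the levels with `k i = 0`. -/
abbrev Edge {n : ℕ} (k : Fin n → ℕ) : Type :=
  Σ i : {i : Fin n // 0 < k i}, Node k i

/-- The node at level `i` on the path from the root to the leaf labelled by `σ`. The spins of
level `j` are the consecutive ones with (0-based) numbers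
`k 0 + ⋯ + k (j - 1), …, k 0 + ⋯ + k j - 1`. -/
def ancestor {n : ℕ} (k : Fin n → ℕ) (σ : Config k) (i : Fin n) : Node k i :=
  fun j m => σ (finSigmaFinEquiv ⟨j, m⟩)

/-- The law of the disorder: independent centred Gaussian variables, one for each edge of `T_k`,
with variance `a i` on the edges that lead to level `i`. -/
def disorder {n : ℕ} (k : Fin n → ℕ) (a : ℕ → ℝ) : Measure (Edge k → ℝ) :=
  Measure.pi fun e => gaussianReal 0 (a e.1).toNNReal

/-- The variable `ε_i^(σ)` of the level-`i` edge on the path from the root to the leaf `σ`; it is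
`0` if there is no such edge, that is, if `k i = 0`. -/
def eps {n : ℕ} (k : Fin n → ℕ) (ω : Edge k → ℝ) (σ : Config k) (i : Fin n) : ℝ :=
  if h : 0 < k i then ω ⟨⟨i, h⟩, ancestor k σ i⟩ else 0

/-- The Hamiltonian `H_k(σ) = -√|k| (ε_1^(σ) + ⋯ + ε_n^(σ))`. -/
def hamiltonian {n : ℕ} (k : Fin n → ℕ) (ω : Edge k → ℝ) (σ : Config k) : ℝ :=
  -√(size k : ℝ) * ∑ i, eps k ω σ i

/-- The partition function `Z_k(β) = ∑_σ exp (-β H_k(σ))`. -/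
def partitionFunction {n : ℕ} (k : Fin n → ℕ) (β : ℝ) (ω : Edge k → ℝ) : ℝ :=
  ∑ σ : Config k, Real.exp (-β * hamiltonian k ω σ)

/-- The number of edges at level `i` of the `N`-th tree is governed by
`k_i(N) = ⌊N log α_i / log 2⌋`. -/
def levelSize (α : ℕ → ℝ) (N i : ℕ) : ℕ :=
  ⌊(N : ℝ) * Real.log (α i) / Real.log 2⌋₊

/-- The number of levels of the `N`-th tree, `n(N) = max {i | k_i(N) > 0}` with levels numbered
from `1`; it is `0` if all `k_i(N)` vanish. -/
def numLevels (α : ℕ → ℝ) (N : ℕ) : ℕ :=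
  sSup {n : ℕ | ∃ i, n = i + 1 ∧ 0 < levelSize α N i}

/-- The finite vector `k(N) = (k_1(N), …, k_{n(N)}(N))`. -/
def levels (α : ℕ → ℝ) (N : ℕ) : Fin (numLevels α N) → ℕ :=
  fun i => levelSize α N i

/-- `log Z_N(β)` as a function of the disorder. -/
def logZ (α : ℕ → ℝ) (β : ℝ) (N : ℕ) (ω : Edge (levels α N) → ℝ) : ℝ :=
  Real.log (partitionFunction (levels α N) β ω)

/-- `α_N(β) = -E log Z_N(β)`. -/
def alphaN (α a : ℕ → ℝ) (β : ℝ) (N : ℕ) : ℝ :=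
  -∫ ω, logZ α β N ω ∂(disorder (levels α N) a)

/-- The quenched free energy density `F_N(β) = -(β |k(N)|)⁻¹ E log Z_N(β)`. -/
def freeEnergy (α a : ℕ → ℝ) (β : ℝ) (N : ℕ) : ℝ :=
  -(1 / (β * (size (levels α N) : ℝ))) * ∫ ω, logZ α β N ω ∂(disorder (levels α N) a)

end GREM

end

/-! The proof is Fekete's lemma for `alphaN`, that is, superadditivity of `E log Z`. After the spins
of each level are split into two groups, a leaf of the tree with level sizes `κ + l` is a pair of
leaves of the trees `κ` and `l`. On pairs, the sum of independent copies of the two smaller fields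
has partition function `Z_κ Z_l`. Since `|κ + l| = |κ| + |l|`, the field of the large tree is also a
sum of two independent parts, with variances proportional to `|κ|` and `|l|`. Each part is less
correlated than the corresponding smaller field: two pairs share a variable only if both of their
initial paths agree.

No Gaussian interpolation is needed. If a Gaussian variable shared by a block of points is replaced
by independent copies on the classes of the block, Jensen's inequality with the Gibbs weights of the
classes shows that `E log Z` does not decrease (`Dominated.split_set`). As this holds for every
external field, it survives adding independent fields (`Dominated.add`), which gives
`add_le_of_hasMeanLse_treeCov`.

Floors give only `k(M) + k(N) ≤ k(M + N)`; the surplus spins form a third tree, with `E log Z ≥ 0`.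
The annealed bound (`HasMeanLse.le_log_card_add`) makes the limit finite, and `|k(N)| / N → 1`
changes the normalisation from `N` to `|k(N)|`. -/

namespace GREM

/-! ### Finite centred Gaussian fields, described by characteristic functions. -/

/-- `μ` is the centred Gaussian law on `S → ℝ` with covariance `C`. -/
structure IsCenteredGaussian {S : Type*} [Fintype S] (μ : Measure (S → ℝ)) (C : S → S → ℝ) :
    Prop where
  isProbabilityMeasure : IsProbabilityMeasure μ
  integral_cexp : ∀ t : S → ℝ, ∫ x, Complex.exp ((∑ s, t s * x s : ℝ) * Complex.I) ∂μ =
    Complex.exp ((-(∑ s, ∑ u, t s * t u * C s u) / 2 : ℝ))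

namespace IsCenteredGaussian

variable {S T : Type*} [Fintype S] [Fintype T] {μ ν : Measure (S → ℝ)} {C D : S → S → ℝ}

@[fun_prop]
theorem continuous_cexp_sum (t : S → ℝ) :
    Continuous fun x : S → ℝ => Complex.exp ((∑ s, t s * x s : ℝ) * Complex.I) := by
  fun_prop

/-- Every linear functional on `S → ℝ` is given by its coefficients, so the covariance fixes the
whole characteristic function. This allows one realisation of a field to be exchanged for another.
-/
theorem unique (hμ : IsCenteredGaussian μ C) (hν : IsCenteredGaussian ν C) : μ = ν := by
  classical
  have := hμ.isProbabilityMeasure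
  have := hν.isProbabilityMeasure
  apply Measure.ext_of_charFunDual
  ext L
  have hL : ∀ x : S → ℝ, L x = ∑ s, L (Pi.single s 1) * x s := by
    intro x
    refine (LinearMap.pi_apply_eq_sum_univ (L : (S → ℝ) →ₗ[ℝ] ℝ) x).trans ?_
    refine Finset.sum_congr rfl fun s _ => ?_
    rw [smul_eq_mul, mul_comm]
    change L _ * _ = _
    congr 2
    ext j
    simp [Pi.single_apply, eq_comm]
  rw [charFunDual_apply, charFunDual_apply, integral_congr_ae (ae_of_all _ fun x => by rw [hL x]),
    integral_congr_ae (μ := ν) (ae_of_all _ fun x => by rw [hL x]),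
    hμ.integral_cexp, hν.integral_cexp]

theorem map_pi_gaussianReal {A : Type*} [Fintype A] (v : A → NNReal) (c : S → A → ℝ) :
    IsCenteredGaussian ((Measure.pi fun a => gaussianReal 0 (v a)).map
      fun x s => ∑ a, c s a * x a) (fun s u => ∑ a, v a * c s a * c u a) where
  isProbabilityMeasure :=
    Measure.isProbabilityMeasure_map (Measurable.aemeasurable (by fun_prop))
  integral_cexp t := by
    rw [integral_map (Measurable.aemeasurable (by fun_prop))
      (continuous_cexp_sum t).aestronglyMeasurable]
    have h1 : ∀ x : A → ℝ, Complex.exp ((∑ s, t s * ∑ a, c s a * x a : ℝ) * Complex.I) =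
        ∏ a, Complex.exp ((∑ s, t s * c s a : ℝ) * x a * Complex.I) := by
      intro x
      rw [← Complex.exp_sum, ← Finset.sum_mul]
      congr 2
      norm_cast
      simp_rw [Finset.mul_sum, Finset.sum_mul]
      rw [Finset.sum_comm]
      refine Finset.sum_congr rfl fun a _ => Finset.sum_congr rfl fun s _ => by ring
    simp_rw [h1]
    rw [integral_fintype_prod_eq_prod
      (f := fun a x => Complex.exp ((∑ s, t s * c s a : ℝ) * (x : ℝ) * Complex.I))]
    simp_rw [← charFun_apply_real, charFun_gaussianReal]
    rw [← Complex.exp_sum]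
    congr 1
    push_cast
    simp only [mul_zero, zero_mul, zero_sub, Finset.sum_neg_distrib, neg_div]
    rw [← Finset.sum_div]
    congr 2
    simp_rw [sq, Finset.sum_mul_sum, Finset.mul_sum]
    rw [Finset.sum_comm]
    refine Finset.sum_congr rfl fun s _ => ?_
    rw [Finset.sum_comm]
    refine Finset.sum_congr rfl fun u _ => Finset.sum_congr rfl fun a _ => by ring

theorem dirac_zero : IsCenteredGaussian (Measure.dirac (0 : S → ℝ)) (fun _ _ => 0) where
  isProbabilityMeasure := inferInstance
  integral_cexp t := by simp

theorem conv (hμ : IsCenteredGaussian μ C) (hν : IsCenteredGaussian ν D) :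
    IsCenteredGaussian (μ ∗ ν) (fun s u => C s u + D s u) := by
  have := hμ.isProbabilityMeasure
  have := hν.isProbabilityMeasure
  refine ⟨inferInstance, fun t => ?_⟩
  have hint : Integrable (fun x : S → ℝ => Complex.exp ((∑ s, t s * x s : ℝ) * Complex.I))
      (μ ∗ ν) := by
    refine (integrable_const (1 : ℝ)).mono (continuous_cexp_sum t).aestronglyMeasurable
      (ae_of_all _ fun x => ?_)
    rw [Complex.norm_exp_ofReal_mul_I]; simp
  rw [integral_conv hint]
  simp only [Pi.add_apply, mul_add, Finset.sum_add_distrib, Complex.ofReal_add, add_mul,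
    Complex.exp_add]
  simp_rw [integral_const_mul, integral_mul_const]
  rw [hμ.integral_cexp, hν.integral_cexp, ← Complex.exp_add, ← Complex.ofReal_add]
  congr 2
  ring

theorem map_precomp (hμ : IsCenteredGaussian μ C) (e : T → S) :
    IsCenteredGaussian (μ.map fun x t => x (e t)) (fun t u => C (e t) (e u)) := by
  classical
  have := hμ.isProbabilityMeasure
  refine ⟨Measure.isProbabilityMeasure_map (Measurable.aemeasurable (by fun_prop)), fun t => ?_⟩
  rw [integral_map (Measurable.aemeasurable (by fun_prop))
      (continuous_cexp_sum t).aestronglyMeasurable]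
  -- `e` need not be injective, so the coefficients are added up over its fibres.
  have h := hμ.integral_cexp (fun s => ∑ i with e i = s, t i)
  have h1 : ∀ y : S → ℝ, ∑ s, (∑ i with e i = s, t i) * y s = ∑ i, t i * y (e i) := by
    intro y
    simp_rw [Finset.sum_mul]
    rw [← Finset.sum_fiberwise Finset.univ e]
    refine Finset.sum_congr rfl fun s _ => Finset.sum_congr rfl fun i hi => ?_
    rw [(Finset.mem_filter.1 hi).2]
  simp_rw [mul_assoc, ← Finset.mul_sum, h1] at h
  rw [h]
  simp_rw [mul_assoc, ← Finset.mul_sum]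

theorem map_eval (hμ : IsCenteredGaussian μ C) (s : S) :
    μ.map (fun x => x s) = gaussianReal 0 (C s s).toNNReal := by
  classical
  have := hμ.isProbabilityMeasure
  have h : ∀ τ : ℝ, charFun (μ.map fun x => x s) τ =
      Complex.exp ((-(τ * τ * C s s) / 2 : ℝ)) := by
    intro τ
    rw [charFun_apply_real, integral_map (measurable_pi_apply s).aemeasurable
      (Continuous.aestronglyMeasurable (by fun_prop))]
    have := hμ.integral_cexp (Pi.single s τ)
    simpa [Pi.single_apply, ite_mul, Finset.sum_ite_eq] using this
  have : IsProbabilityMeasure (μ.map fun x => x s) :=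
    Measure.isProbabilityMeasure_map (measurable_pi_apply s).aemeasurable
  -- Positivity of `C` is not part of the structure; it follows from the bound `1` on a
  -- characteristic function.
  have hC : 0 ≤ C s s := by
    have h1 := norm_charFun_le_one (μ := μ.map fun x => x s) 1
    rw [h, Complex.norm_exp_ofReal, Real.exp_le_one_iff] at h1
    linarith
  apply Measure.ext_of_charFun
  ext τ
  rw [h, charFun_gaussianReal]
  congr 1
  rw [Real.coe_toNNReal _ hC]
  push_cast
  ring

theorem integrable_comp_eval (hμ : IsCenteredGaussian μ C) (s : S) {f : ℝ → ℝ}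
    (hf : Integrable f (gaussianReal 0 (C s s).toNNReal)) : Integrable (fun x => f (x s)) μ := by
  rw [← hμ.map_eval s] at hf
  exact hf.comp_measurable (by fun_prop)

theorem integral_comp_eval (hμ : IsCenteredGaussian μ C) (s : S) {f : ℝ → ℝ}
    (hf : Continuous f) :
    ∫ x, f (x s) ∂μ = ∫ y, f y ∂gaussianReal 0 (C s s).toNNReal := by
  rw [← hμ.map_eval s, integral_map (measurable_pi_apply s).aemeasurable hf.aestronglyMeasurable]

theorem integrable_eval (hμ : IsCenteredGaussian μ C) (s : S) : Integrable (fun x => x s) μ :=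
  hμ.integrable_comp_eval s IsGaussian.integrable_id

theorem integral_eval (hμ : IsCenteredGaussian μ C) (s : S) : ∫ x, x s ∂μ = 0 := by
  rw [hμ.integral_comp_eval s (f := fun y => y) continuous_id]
  exact integral_id_gaussianReal

theorem integrable_exp_eval (hμ : IsCenteredGaussian μ C) (s : S) :
    Integrable (fun x => Real.exp (x s)) μ :=
  hμ.integrable_comp_eval s (by simpa using integrable_exp_mul_gaussianReal (μ := 0) 1)

theorem integral_exp_eval_le (hμ : IsCenteredGaussian μ C) (s : S) {c : ℝ} (hc : 0 ≤ c)
    (h : C s s ≤ c) : ∫ x, Real.exp (x s) ∂μ ≤ Real.exp (c / 2) := by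
  rw [hμ.integral_comp_eval s (f := fun y => Real.exp y) (by fun_prop)]
  have := congrFun (mgf_id_gaussianReal (μ := 0) (v := (C s s).toNNReal)) 1
  simp only [mgf, id, one_mul] at this
  rw [this]
  have := Real.toNNReal_le_toNNReal h
  rw [← NNReal.coe_le_coe, Real.coe_toNNReal c hc] at this
  gcongr
  linarith

end IsCenteredGaussian

end GREM

namespace GREM

/-! ### Pointwise inequalities for the log-sum-exp function. -/

section LogSumExp

variable {S : Type*} [Fintype S]

/-- The function `x ↦ log (∑ s, exp (x s))`. -/
noncomputable def lse (x : S → ℝ) : ℝ := Real.log (∑ s, Real.exp (x s))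

theorem sum_exp_pos [Nonempty S] (x : S → ℝ) : 0 < ∑ s, Real.exp (x s) :=
  Finset.sum_pos (fun _ _ => Real.exp_pos _) Finset.univ_nonempty

theorem continuous_lse [Nonempty S] : Continuous (lse : (S → ℝ) → ℝ) :=
  Continuous.log (by fun_prop) fun x => (sum_exp_pos x).ne'

theorem lse_zero : lse (fun _ : S => (0 : ℝ)) = Real.log (Fintype.card S) := by
  simp [lse]

theorem lse_comp_equiv {T : Type*} [Fintype T] (e : T ≃ S) (x : S → ℝ) :
    lse (fun t => x (e t)) = lse x := by
  unfold lse
  rw [Equiv.sum_comp e (fun s => Real.exp (x s))]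

theorem lse_prod {T : Type*} [Fintype T] [Nonempty S] [Nonempty T] (x : S → ℝ) (y : T → ℝ) :
    lse (fun p : S × T => x p.1 + y p.2) = lse x + lse y := by
  unfold lse
  rw [← Real.log_mul (sum_exp_pos x).ne' (sum_exp_pos y).ne', Finset.sum_mul_sum,
    Fintype.sum_prod_type]
  simp_rw [Real.exp_add]

theorem abs_lse_le [Nonempty S] (x : S → ℝ) :
    |lse x| ≤ Real.log (Fintype.card S) + ∑ s, |x s| := by
  have hle : ∀ s, |x s| ≤ ∑ s, |x s| := fun s =>
    Finset.single_le_sum (f := fun s => |x s|) (fun _ _ => abs_nonneg _) (Finset.mem_univ s)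
  have hcard : (1 : ℝ) ≤ Fintype.card S := by exact_mod_cast Fintype.card_pos
  rw [abs_le]
  constructor
  · obtain ⟨s⟩ := ‹Nonempty S›
    have h : x s ≤ lse x := by
      rw [lse, Real.le_log_iff_exp_le (Finset.sum_pos (fun _ _ => Real.exp_pos _) ⟨s, by simp⟩)]
      exact Finset.single_le_sum (f := fun s => Real.exp (x s)) (fun _ _ => (Real.exp_pos _).le)
        (Finset.mem_univ s)
    have := neg_abs_le (x s)
    have := hle s
    have := Real.log_nonneg hcard
    linarith
  · rw [lse, Real.log_le_iff_le_exp (sum_exp_pos x), Real.exp_add,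
      Real.exp_log (by linarith)]
    calc ∑ s, Real.exp (x s) ≤ ∑ _s : S, Real.exp (∑ s, |x s|) :=
          Finset.sum_le_sum fun s _ => Real.exp_le_exp.2 ((le_abs_self _).trans (hle s))
      _ = _ := by simp

/-- Jensen's inequality for the logarithm of a finite sum of exponentials. -/
theorem sum_mul_lse_le {A : Type*} [Fintype A] [Nonempty S] (w : A → ℝ) (hw : ∀ a, 0 ≤ w a)
    (hw1 : ∑ a, w a = 1) (x : A → S → ℝ) (y : S → ℝ)
    (h : ∑ a, w a * ∑ s, Real.exp (x a s) = ∑ s, Real.exp (y s)) :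
    ∑ a, w a * lse (x a) ≤ lse y := by
  have := strictConcaveOn_log_Ioi.concaveOn.le_map_sum (t := Finset.univ) (w := w)
    (p := fun a => ∑ s, Real.exp (x a s)) (fun a _ => hw a) hw1 (fun a _ => sum_exp_pos (x a))
  simp only [smul_eq_mul] at this
  rw [h] at this
  exact this

/-- The difference `lse (h + x) - lse h` is the logarithm of the Gibbs average of `exp x`, to which
Jensen's inequality applies. -/
theorem lse_add_sum_le [Nonempty S] (h x : S → ℝ) :
    lse h + ∑ s, Real.exp (h s) / (∑ u, Real.exp (h u)) * x s ≤ lse (fun s => h s + x s) := by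
  have hZ := sum_exp_pos h
  have := strictConcaveOn_log_Ioi.concaveOn.le_map_sum (t := Finset.univ)
    (w := fun s => Real.exp (h s) / (∑ u, Real.exp (h u))) (p := fun s => Real.exp (x s))
    (fun s _ => by positivity) (by rw [← Finset.sum_div, div_self hZ.ne'])
    (fun s _ => Real.exp_pos _)
  simp only [smul_eq_mul, Real.log_exp] at this
  have h2 : lse (fun s => h s + x s) = lse h + Real.log
      (∑ s, Real.exp (h s) / (∑ u, Real.exp (h u)) * Real.exp (x s)) := by
    unfold lse
    rw [← Real.log_mul hZ.ne' (Finset.sum_pos (fun s _ => by positivity)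
      Finset.univ_nonempty).ne', Finset.mul_sum]
    congr 1
    refine Finset.sum_congr rfl fun s _ => ?_
    rw [Real.exp_add]
    field_simp
  rw [h2]
  linarith

end LogSumExp

/-! ### Comparison of covariances by Jensen's inequality. -/

variable {S : Type*} [Fintype S] {μ ν : Measure (S → ℝ)} {C D E F : S → S → ℝ}

theorem IsCenteredGaussian.integrable_lse [Nonempty S] (hμ : IsCenteredGaussian μ C)
    (h : S → ℝ) : Integrable (fun x => lse (fun s => h s + x s)) μ := by
  have := hμ.isProbabilityMeasure
  refine Integrable.mono'
    (g := fun x => Real.log (Fintype.card S) + ∑ s, (|h s| + |x s|)) ?_ ?_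
    (ae_of_all _ fun x => (abs_lse_le _).trans ?_)
  · exact (integrable_const _).add (integrable_finsetSum _ fun s _ =>
      (integrable_const _).add (hμ.integrable_eval s).abs)
  · exact (continuous_lse.comp (by fun_prop)).aestronglyMeasurable
  · gcongr
    exact abs_add_le _ _

/-- The covariance `C` is dominated by the covariance `D`: the mean of the logarithm of the
partition function with any external field is smaller for `C` than for `D`. -/
def Dominated (C D : S → S → ℝ) : Prop :=
  ∃ μ ν, IsCenteredGaussian μ C ∧ IsCenteredGaussian ν D ∧
    ∀ h : S → ℝ, ∫ x, lse (fun s => h s + x s) ∂μ ≤ ∫ x, lse (fun s => h s + x s) ∂ν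

namespace Dominated

theorem of_isCenteredGaussian (hμ : IsCenteredGaussian μ C) : Dominated C C :=
  ⟨μ, μ, hμ, hμ, fun _ => le_rfl⟩

/-- By Fubini, a fixed value of the `ρ`-field merely shifts the external field. This is why
domination is required for all `h`. -/
theorem integral_conv_lse_le [Nonempty S] {ρ : Measure (S → ℝ)} (hμ : IsCenteredGaussian μ C)
    (hν : IsCenteredGaussian ν D) (hρ : IsCenteredGaussian ρ E)
    (hle : ∀ h : S → ℝ, ∫ x, lse (fun s => h s + x s) ∂μ ≤ ∫ x, lse (fun s => h s + x s) ∂ν)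
    (h : S → ℝ) :
    ∫ x, lse (fun s => h s + x s) ∂(ρ ∗ μ) ≤ ∫ x, lse (fun s => h s + x s) ∂(ρ ∗ ν) := by
  have := hμ.isProbabilityMeasure
  have := hν.isProbabilityMeasure
  have := hρ.isProbabilityMeasure
  have hi : ∀ {κ : Measure (S → ℝ)} {G : S → S → ℝ} [IsProbabilityMeasure κ],
      IsCenteredGaussian κ G → Integrable
        (fun p : (S → ℝ) × (S → ℝ) => lse (fun s => h s + (p.1 + p.2) s)) (ρ.prod κ) := by
    intro κ G _ hκ
    exact ((hρ.conv hκ).integrable_lse h).comp_measurable (by fun_prop)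
  rw [integral_conv ((hρ.conv hμ).integrable_lse h), integral_conv ((hρ.conv hν).integrable_lse h)]
  refine integral_mono (hi hμ).integral_prod_left (hi hν).integral_prod_left fun x => ?_
  simpa only [Pi.add_apply, add_assoc] using hle (fun s => h s + x s)

theorem add [Nonempty S] (h₁ : Dominated C D) (h₂ : Dominated E F) :
    Dominated (fun s u => C s u + E s u) (fun s u => D s u + F s u) := by
  obtain ⟨μ, ν, hμ, hν, h⟩ := h₁
  obtain ⟨μ', ν', hμ', hν', h'⟩ := h₂
  have := hμ.isProbabilityMeasure
  have := hν.isProbabilityMeasure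
  have := hμ'.isProbabilityMeasure
  refine ⟨μ ∗ μ', ν ∗ ν', hμ.conv hμ', hν.conv hν', fun f => ?_⟩
  refine (integral_conv_lse_le hμ' hν' hμ h' f).trans ?_
  have := hν'.isProbabilityMeasure
  rw [Measure.conv_comm μ, Measure.conv_comm ν]
  exact integral_conv_lse_le hμ hν hν' h f

theorem sum [Nonempty S] {J : Type*} (t : Finset J) {C D : J → S → S → ℝ}
    (h : ∀ j ∈ t, Dominated (C j) (D j)) :
    Dominated (fun s u => ∑ j ∈ t, C j s u) (fun s u => ∑ j ∈ t, D j s u) := by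
  classical
  induction t using Finset.induction_on with
  | empty => simpa using of_isCenteredGaussian IsCenteredGaussian.dirac_zero
  | insert j t hj ih =>
    simp_rw [Finset.sum_insert hj]
    exact (h j (by simp)).add (ih fun i hi => h i (by simp [hi]))

/-- In the Jensen lower bound the term linear in `x` has mean zero. -/
theorem zero_left [Nonempty S] (hμ : IsCenteredGaussian μ C) :
    Dominated (fun _ _ => 0) C := by
  refine ⟨_, μ, IsCenteredGaussian.dirac_zero, hμ, fun h => ?_⟩
  have := hμ.isProbabilityMeasure
  rw [integral_dirac]
  simp only [Pi.zero_apply, add_zero]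
  have hi : ∀ s, Integrable (fun x : S → ℝ =>
      Real.exp (h s) / (∑ u, Real.exp (h u)) * x s) μ :=
    fun s => (hμ.integrable_eval s).const_mul _
  calc lse h = ∫ x, (lse h + ∑ s, Real.exp (h s) / (∑ u, Real.exp (h u)) * x s) ∂μ := by
        rw [integral_add (integrable_const _) (integrable_finsetSum _ fun s _ => hi s),
          integral_finsetSum _ fun s _ => hi s]
        simp_rw [integral_const_mul, hμ.integral_eval]
        simp
    _ ≤ _ := integral_mono
        ((integrable_const _).add (integrable_finsetSum _ fun s _ => hi s))
        (hμ.integrable_lse h) fun x => lse_add_sum_le h x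

open Classical in
/-- A Gaussian variable shared by the points of `p` may be replaced by independent copies, one for
each value of `g`. -/
theorem split_set [Nonempty S] {A : Type*} [Fintype A] (v : NNReal) (p : S → Prop) (g : S → A) :
    Dominated (fun s u => if p s ∧ p u then (v : ℝ) else 0)
      (fun s u => if p s ∧ p u ∧ g s = g u then (v : ℝ) else 0) := by
  set P : Measure (A → ℝ) := Measure.pi fun _ => gaussianReal 0 v with hP
  have hμ : ∀ a, IsCenteredGaussian
      (P.map fun x s => ∑ b, (if p s ∧ b = a then (1 : ℝ) else 0) * x b)
      (fun s u => if p s ∧ p u then (v : ℝ) else 0) := by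
    intro a
    convert IsCenteredGaussian.map_pi_gaussianReal (fun _ : A => v)
      (fun (s : S) b => if p s ∧ b = a then (1 : ℝ) else 0) using 3 with s u
    by_cases hs : p s <;> by_cases hu : p u <;> simp [hs, hu]
  have hν : IsCenteredGaussian
      (P.map fun x s => ∑ b, (if p s ∧ g s = b then (1 : ℝ) else 0) * x b)
      (fun s u => if p s ∧ p u ∧ g s = g u then (v : ℝ) else 0) := by
    convert IsCenteredGaussian.map_pi_gaussianReal (fun _ : A => v)
      (fun (s : S) b => if p s ∧ g s = b then (1 : ℝ) else 0) using 3 with s u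
    by_cases hs : p s <;> by_cases hu : p u <;> simp [hs, hu, eq_comm]
  have hX : ∀ a (x : A → ℝ) (s : S), ∑ b, (if p s ∧ b = a then (1 : ℝ) else 0) * x b =
      if p s then x a else 0 := by
    intro a x s
    by_cases hs : p s <;> simp [hs]
  have hY : ∀ (x : A → ℝ) (s : S), ∑ b, (if p s ∧ g s = b then (1 : ℝ) else 0) * x b =
      if p s then x (g s) else 0 := by
    intro x s
    by_cases hs : p s <;> simp [hs]
  simp_rw [hX] at hμ
  simp_rw [hY] at hν
  obtain ⟨s₀⟩ := ‹Nonempty S›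
  have : Nonempty S := ⟨s₀⟩
  have hmX : ∀ a, Measurable fun (x : A → ℝ) (s : S) => if p s then x a else 0 := by
    intro a
    refine measurable_pi_lambda _ fun s => ?_
    by_cases hs : p s <;> simp [hs, measurable_pi_apply]
  have hmY : Measurable fun (x : A → ℝ) (s : S) => if p s then x (g s) else 0 := by
    refine measurable_pi_lambda _ fun s => ?_
    by_cases hs : p s <;> simp [hs, measurable_pi_apply]
  refine ⟨_, _, hμ (g s₀), hν, fun h => ?_⟩
  have hcont : Continuous fun x : S → ℝ => lse fun s => h s + x s :=
    continuous_lse.comp (by fun_prop)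
  -- `w a` is the share of the class `g = a` in the Gibbs mass of the block `p`. For an empty block
  -- any probability weights would do.
  obtain ⟨w, hw0, hw1, hw⟩ : ∃ w : A → ℝ, (∀ a, 0 ≤ w a) ∧ ∑ a, w a = 1 ∧
      ∀ a, w a * ∑ s with p s, Real.exp (h s) = ∑ s with p s ∧ g s = a, Real.exp (h s) := by
    by_cases hp : ∃ s, p s
    · have hpos : 0 < ∑ s with p s, Real.exp (h s) := by
        obtain ⟨s, hs⟩ := hp
        exact Finset.sum_pos (fun _ _ => Real.exp_pos _) ⟨s, by simp [hs]⟩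
      refine ⟨fun a => (∑ s with p s ∧ g s = a, Real.exp (h s)) / ∑ s with p s, Real.exp (h s),
        fun a => by positivity, ?_, fun a => div_mul_cancel₀ _ hpos.ne'⟩
      rw [← Finset.sum_div, div_eq_one_iff_eq hpos.ne', ← Finset.sum_fiberwise _ g]
      simp_rw [Finset.filter_filter]
    · push Not at hp
      exact ⟨fun a => if a = g s₀ then 1 else 0, fun a => by positivity, by simp, by simp [hp]⟩
  have hJ : ∀ x : A → ℝ, ∑ a, w a * lse (fun s => h s + if p s then x a else 0) ≤
      lse (fun s => h s + if p s then x (g s) else 0) := by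
    intro x
    refine sum_mul_lse_le w hw0 hw1 _ _ ?_
    have hsplit : ∀ y : S → ℝ, ∑ s, Real.exp (h s + if p s then y s else 0) =
        ∑ s with p s, Real.exp (h s) * Real.exp (y s) + ∑ s with ¬ p s, Real.exp (h s) := by
      intro y
      rw [← Finset.sum_filter_add_sum_filter_not _ p]
      congr 1
      · refine Finset.sum_congr rfl fun s hs => ?_
        rw [if_pos (Finset.mem_filter.1 hs).2, Real.exp_add]
      · refine Finset.sum_congr rfl fun s hs => ?_
        rw [if_neg (Finset.mem_filter.1 hs).2, add_zero]
    rw [hsplit fun s => x (g s)]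
    simp_rw [hsplit fun _ => x _, mul_add, Finset.sum_add_distrib, ← Finset.sum_mul, ← mul_assoc,
      hw]
    rw [hw1, one_mul]
    congr 1
    rw [← Finset.sum_fiberwise _ g]
    simp_rw [Finset.filter_filter, Finset.sum_mul]
    refine Finset.sum_congr rfl fun a _ => Finset.sum_congr rfl fun s hs => ?_
    rw [(Finset.mem_filter.1 hs).2.2]
  have hiX : ∀ a, Integrable (fun x => w a * lse (fun s => h s + if p s then x a else 0)) P :=
    fun a => (((hμ a).integrable_lse h).comp_measurable (hmX a)).const_mul _
  have hiY : Integrable (fun x => lse (fun s => h s + if p s then x (g s) else 0)) P :=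
    (hν.integrable_lse h).comp_measurable hmY
  calc ∫ x, lse (fun s => h s + x s) ∂(P.map fun x s => if p s then x (g s₀) else 0)
      -- All copies have the same law, so averaging over which copy is shared changes nothing.
      = ∑ a, w a * ∫ x, lse (fun s => h s + x s) ∂(P.map fun x s => if p s then x a else 0) := by
        simp_rw [fun a => (hμ a).unique (hμ (g s₀)), ← Finset.sum_mul, hw1, one_mul]
    _ = ∫ x, ∑ a, w a * lse (fun s => h s + if p s then x a else 0) ∂P := by
        rw [integral_finsetSum _ fun a _ => hiX a]
        refine Finset.sum_congr rfl fun a _ => ?_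
        rw [integral_const_mul, integral_map (hmX a).aemeasurable hcont.aestronglyMeasurable]
    _ ≤ ∫ x, lse (fun s => h s + if p s then x (g s) else 0) ∂P :=
        integral_mono (integrable_finsetSum _ fun a _ => hiX a) hiY hJ
    _ = _ := (integral_map hmY.aemeasurable hcont.aestronglyMeasurable).symm

open Classical in
-- Each fibre of `f` carries its own independent variable, so the one-block comparison can be summed
-- over the fibres.
theorem split [Nonempty S] {A B : Type*} [Fintype A] [Fintype B] {v : ℝ} (hv : 0 ≤ v)
    (f : S → B) (g : S → A) :
    Dominated (fun s u => if f s = f u then v else 0)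
      (fun s u => if f s = f u ∧ g s = g u then v else 0) := by
  lift v to NNReal using hv
  convert Dominated.sum (Finset.univ : Finset B)
    (fun b _ => split_set v (fun s : S => f s = b) g) using 3 with s u s u
  · by_cases h : f s = f u <;> simp [ite_and, h, eq_comm]
  · by_cases h : f s = f u <;> simp [ite_and, h, eq_comm]

end Dominated

end GREM

/-! ### Mean log-partition functions of Gaussian fields. -/

namespace GREM

variable {S T : Type*} [Fintype S] [Fintype T] {C : S → S → ℝ} {D : T → T → ℝ} {p q : ℝ}

/-- The mean of `log (∑ s, exp (x s))` for the centred Gaussian field with covariance `C` is `p`. -/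
def HasMeanLse (C : S → S → ℝ) (p : ℝ) : Prop :=
  ∃ μ, IsCenteredGaussian μ C ∧ ∫ x, lse x ∂μ = p

theorem Dominated.exists_hasMeanLse {D : S → S → ℝ} (h : Dominated C D) :
    ∃ p, HasMeanLse C p := by
  obtain ⟨μ, _, hμ, _⟩ := h
  exact ⟨_, μ, hμ, rfl⟩

theorem IsCenteredGaussian.integrable_lse_self [Nonempty S] {μ : Measure (S → ℝ)}
    (hμ : IsCenteredGaussian μ C) : Integrable (fun x => lse x) μ := by
  simpa using hμ.integrable_lse fun _ => 0

namespace HasMeanLse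

theorem comp_equiv [Nonempty S] (h : HasMeanLse C p) (e : T ≃ S) :
    HasMeanLse (fun s u => C (e s) (e u)) p := by
  obtain ⟨μ, hμ, rfl⟩ := h
  have : Nonempty T := ⟨e.symm (Classical.arbitrary S)⟩
  refine ⟨_, hμ.map_precomp e, ?_⟩
  rw [integral_map (Measurable.aemeasurable (by fun_prop))
    continuous_lse.aestronglyMeasurable]
  simp_rw [lse_comp_equiv]

/-- For a sum of independent fields on the two factors, the partition function factorises. -/
theorem prod [Nonempty S] [Nonempty T] (h : HasMeanLse C p) (h' : HasMeanLse D q) :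
    HasMeanLse (fun s u : S × T => C s.1 u.1 + D s.2 u.2) (p + q) := by
  obtain ⟨μ, hμ, rfl⟩ := h
  obtain ⟨ν, hν, rfl⟩ := h'
  have := hμ.isProbabilityMeasure
  have := hν.isProbabilityMeasure
  have hμ' := hμ.map_precomp (Prod.fst : S × T → S)
  have hν' := hν.map_precomp (Prod.snd : S × T → T)
  have := hμ'.isProbabilityMeasure
  have := hν'.isProbabilityMeasure
  refine ⟨_, hμ'.conv hν', ?_⟩
  have hmS : Measurable fun (x : S → ℝ) (t : S × T) => x t.1 := by fun_prop
  have hmT : Measurable fun (x : T → ℝ) (t : S × T) => x t.2 := by fun_prop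
  rw [integral_conv (hμ'.conv hν').integrable_lse_self,
    integral_map hmS.aemeasurable]
  · have : ∀ x : S → ℝ, ∫ y, lse ((fun t : S × T => x t.1) + y) ∂(ν.map fun x t => x t.2) =
        lse x + ∫ y, lse y ∂ν := by
      intro x
      have hc : Continuous fun y : S × T → ℝ => lse ((fun t : S × T => x t.1) + y) :=
        continuous_lse.comp (by fun_prop)
      rw [integral_map hmT.aemeasurable hc.aestronglyMeasurable]
      have : ∀ y : T → ℝ, lse ((fun t : S × T => x t.1) + fun t => y t.2) = lse x + lse y :=
        fun y => lse_prod x y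
      simp_rw [this]
      rw [integral_add (integrable_const _) hν.integrable_lse_self]
      simp
    simp_rw [this]
    rw [integral_add hμ.integrable_lse_self (integrable_const _)]
    simp
  · have hm : StronglyMeasurable fun z : (S × T → ℝ) × (S × T → ℝ) => lse (z.1 + z.2) :=
      (continuous_lse.comp (by fun_prop)).stronglyMeasurable
    exact hm.integral_prod_right.aestronglyMeasurable

theorem le_of_dominated {D : S → S → ℝ} (h : HasMeanLse C p) (h' : HasMeanLse D q)
    (hCD : Dominated C D) : p ≤ q := by
  obtain ⟨μ, hμ, rfl⟩ := h
  obtain ⟨ν, hν, rfl⟩ := h'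
  obtain ⟨μ', ν', hμ', hν', hle⟩ := hCD
  rw [hμ.unique hμ', hν.unique hν']
  simpa using hle fun _ => 0

theorem log_card_le [Nonempty S] (h : HasMeanLse C p) : Real.log (Fintype.card S) ≤ p := by
  obtain ⟨μ, hμ, -⟩ := id h
  refine le_of_dominated ⟨_, IsCenteredGaussian.dirac_zero, ?_⟩ h (Dominated.zero_left hμ)
  rw [integral_dirac]
  exact lse_zero

/-- The annealed bound `E log Z ≤ log M`, where `M` bounds `E Z`. It is obtained by integrating the
tangent-line inequality `log z ≤ log M + z / M - 1`. -/
theorem le_log_card_add [Nonempty S] (h : HasMeanLse C p) {c : ℝ} (hc : 0 ≤ c)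
    (hC : ∀ s, C s s ≤ c) : p ≤ Real.log (Fintype.card S) + c / 2 := by
  obtain ⟨μ, hμ, rfl⟩ := h
  have := hμ.isProbabilityMeasure
  have hcard : (0 : ℝ) < Fintype.card S := by exact_mod_cast Fintype.card_pos
  set M : ℝ := Fintype.card S * Real.exp (c / 2) with hM
  have hMpos : 0 < M := by positivity
  have hlogM : Real.log M = Real.log (Fintype.card S) + c / 2 := by
    rw [hM, Real.log_mul hcard.ne' (Real.exp_pos _).ne', Real.log_exp]
  rw [← hlogM]
  have hle : ∀ x : S → ℝ, lse x ≤ Real.log M + ((∑ s, Real.exp (x s)) / M - 1) := by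
    intro x
    have := Real.log_le_sub_one_of_pos (div_pos (sum_exp_pos x) hMpos)
    rw [Real.log_div (sum_exp_pos x).ne' hMpos.ne'] at this
    unfold lse
    linarith
  have hi : Integrable (fun x : S → ℝ => ∑ s, Real.exp (x s)) μ :=
    integrable_finsetSum _ fun s _ => hμ.integrable_exp_eval s
  have hi' : Integrable (fun x : S → ℝ => (∑ s, Real.exp (x s)) / M - 1) μ :=
    (hi.div_const _).sub (integrable_const _)
  calc ∫ x, lse x ∂μ ≤ ∫ x, (Real.log M + ((∑ s, Real.exp (x s)) / M - 1)) ∂μ :=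
        integral_mono hμ.integrable_lse_self ((integrable_const _).add hi') hle
    _ = Real.log M + ((∑ s, ∫ x, Real.exp (x s) ∂μ) / M - 1) := by
        rw [integral_add (integrable_const _) hi',
          integral_sub (hi.div_const _) (integrable_const _), integral_div,
          integral_finsetSum _ fun s _ => hμ.integrable_exp_eval s]
        simp
    _ ≤ Real.log M + (M / M - 1) := by
        gcongr
        calc ∑ s, ∫ x, Real.exp (x s) ∂μ ≤ ∑ _s : S, Real.exp (c / 2) :=
              Finset.sum_le_sum fun s _ => hμ.integral_exp_eval_le s hc (hC s)
          _ = M := by simp [hM]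
    _ = Real.log M := by rw [div_self hMpos.ne']; ring

end HasMeanLse

open Classical in
-- `P` and `Q` say that the level is nonempty before and after merging. If it is nonempty only after
-- merging, a new field is added to zero, which cannot lower the mean.
theorem Dominated.level [Nonempty S] {A B : Type*} [Fintype A] [Fintype B] {v : ℝ} (hv : 0 ≤ v)
    {P Q : Prop} (hPQ : P → Q) (f : S → B) (g : S → A) :
    Dominated (fun s u => if P ∧ f s = f u then v else 0)
      (fun s u => if Q ∧ f s = f u ∧ g s = g u then v else 0) := by
  have h := Dominated.split hv f g
  by_cases hP : P
  · simpa [hP, hPQ hP] using h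
  · by_cases hQ : Q
    · obtain ⟨_, ν, -, hν, -⟩ := h
      simpa [hP, hQ] using Dominated.zero_left hν
    · simpa [hP, hQ] using Dominated.of_isCenteredGaussian
        (IsCenteredGaussian.dirac_zero (S := S))

/-! ### Tree covariances and superadditivity in the level sizes. -/

section Tree

/-- The leaves of the tree with `n` levels, the edges of level `i` carrying `κ i` spins. -/
abbrev Leaf (n : ℕ) (κ : ℕ → ℕ) : Type := (i : Fin n) → Fin (κ i) → ℤˣ

variable {n : ℕ} {κ l : ℕ → ℕ}

/-- The part of the path to the leaf `s` up to level `i`. -/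
def initialPath (i : ℕ) (s : Leaf n κ) : (j : {j : Fin n // (j : ℕ) ≤ i}) → Fin (κ j) → ℤˣ :=
  fun j => s j

theorem initialPath_eq_iff {i : ℕ} {s u : Leaf n κ} :
    initialPath i s = initialPath i u ↔ ∀ j : Fin n, (j : ℕ) ≤ i → s j = u j := by
  simp [funext_iff, initialPath, Subtype.forall]

open Classical in
/-- The covariance of `-β H` on the leaves of the tree. -/
noncomputable def treeCov (a : ℕ → ℝ) (β : ℝ) (n : ℕ) (κ : ℕ → ℕ) (s u : Leaf n κ) : ℝ :=
  ∑ i ∈ Finset.range n, if 0 < κ i ∧ initialPath i s = initialPath i u then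
    β ^ 2 * (∑ j ∈ Finset.range n, (κ j : ℝ)) * a i else 0

variable {a : ℕ → ℝ} {β : ℝ}

theorem exists_hasMeanLse_treeCov (ha : ∀ i, 0 ≤ a i) (β : ℝ) (n : ℕ) (κ : ℕ → ℕ) :
    ∃ p, HasMeanLse (treeCov a β n κ) p := by
  classical
  convert (Dominated.sum (Finset.range n) fun i _ => Dominated.level
    (v := β ^ 2 * (∑ j ∈ Finset.range n, (κ j : ℝ)) * a i)
    (mul_nonneg (by positivity) (ha i)) (P := 0 < κ i) id
    (initialPath (n := n) (κ := κ) i) (fun _ => ())).exists_hasMeanLse using 3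
  funext s u
  unfold treeCov
  congr! 2

/-- Splitting the spins of every level into two groups. -/
def leafAddEquiv (n : ℕ) (κ l : ℕ → ℕ) :
    Leaf n (fun i => κ i + l i) ≃ Leaf n κ × Leaf n l where
  toFun s := (fun i m => s i (Fin.castAdd _ m), fun i m => s i (Fin.natAdd _ m))
  invFun s i := Fin.append (s.1 i) (s.2 i)
  left_inv s := by
    funext i
    exact Fin.append_castAdd_natAdd
  right_inv s := by simp

theorem initialPath_leafAddEquiv {i : ℕ} {s u : Leaf n fun i => κ i + l i} :
    initialPath i s = initialPath i u ↔
      initialPath i (leafAddEquiv n κ l s).1 = initialPath i (leafAddEquiv n κ l u).1 ∧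
      initialPath i (leafAddEquiv n κ l s).2 = initialPath i (leafAddEquiv n κ l u).2 := by
  simp only [initialPath_eq_iff, ← forall_and]
  refine forall₂_congr fun j _ => ?_
  constructor
  · intro h
    simp [leafAddEquiv, h]
  · rintro ⟨h₁, h₂⟩
    funext m
    induction m using Fin.addCases with
    | left m => exact congrFun h₁ m
    | right m => exact congrFun h₂ m

/-- The variance of the merged tree splits as `|κ| + |l|`. In the `|κ|` part each level variable is
refined along the `l`-path, and in the `|l|` part along the `κ`-path. -/
theorem add_le_of_hasMeanLse_treeCov (ha : ∀ i, 0 ≤ a i) {p q r : ℝ}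
    (hp : HasMeanLse (treeCov a β n κ) p) (hq : HasMeanLse (treeCov a β n l) q)
    (hr : HasMeanLse (treeCov a β n fun i => κ i + l i) r) : p + q ≤ r := by
  classical
  have hr' := hr.comp_equiv (leafAddEquiv n κ l).symm
  refine (hp.prod hq).le_of_dominated hr' ?_
  convert (Dominated.sum (S := Leaf n κ × Leaf n l) (Finset.range n) fun i _ => Dominated.level
    (v := β ^ 2 * (∑ j ∈ Finset.range n, (κ j : ℝ)) * a i)
    (mul_nonneg (by positivity) (ha i)) (P := 0 < κ i) (Q := 0 < κ i + l i) (by omega)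
    (fun s : Leaf n κ × Leaf n l => initialPath i s.1)
    (fun s : Leaf n κ × Leaf n l => initialPath i s.2)).add
    (Dominated.sum (S := Leaf n κ × Leaf n l) (Finset.range n) fun i _ => Dominated.level
    (v := β ^ 2 * (∑ j ∈ Finset.range n, (l j : ℝ)) * a i)
    (mul_nonneg (by positivity) (ha i)) (P := 0 < l i) (Q := 0 < κ i + l i) (by omega)
    (fun s : Leaf n κ × Leaf n l => initialPath i s.2)
    (fun s : Leaf n κ × Leaf n l => initialPath i s.1)) using 1
  · funext s u
    unfold treeCov
    congr! 3
  funext s u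
  unfold treeCov
  rw [← Finset.sum_add_distrib]
  refine Finset.sum_congr rfl fun i _ => ?_
  simp only [initialPath_leafAddEquiv, Equiv.apply_symm_apply]
  by_cases h1 : 0 < κ i + l i <;> by_cases h2 : initialPath i s.1 = initialPath i u.1 <;>
    by_cases h3 : initialPath i s.2 = initialPath i u.2 <;>
    simp [h1, h2, h3, Finset.sum_add_distrib, mul_add, add_mul]

theorem hasMeanLse_treeCov_nonneg {p : ℝ} (hp : HasMeanLse (treeCov a β n κ) p) : 0 ≤ p :=
  (Real.log_nonneg (by exact_mod_cast Fintype.card_pos)).trans hp.log_card_le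

/-- The excess `d` of `ρ` over `κ + l` is split off as another tree, whose contribution is
nonnegative. -/
theorem add_le_of_hasMeanLse_treeCov_of_le (ha : ∀ i, 0 ≤ a i) {ρ : ℕ → ℕ}
    (hle : ∀ i, κ i + l i ≤ ρ i) {p q r : ℝ}
    (hp : HasMeanLse (treeCov a β n κ) p) (hq : HasMeanLse (treeCov a β n l) q)
    (hr : HasMeanLse (treeCov a β n ρ) r) : p + q ≤ r := by
  obtain ⟨d, rfl⟩ : ∃ d : ℕ → ℕ, ρ = fun i => (κ i + l i) + d i :=
    ⟨fun i => ρ i - (κ i + l i), by funext i; have := hle i; dsimp only; omega⟩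
  obtain ⟨r', hr'⟩ := exists_hasMeanLse_treeCov ha β n fun i => κ i + l i
  obtain ⟨t, ht⟩ := exists_hasMeanLse_treeCov ha β n d
  have h1 := add_le_of_hasMeanLse_treeCov ha hp hq hr'
  have h2 := add_le_of_hasMeanLse_treeCov ha hr' ht hr
  have h3 := hasMeanLse_treeCov_nonneg ht
  linarith

theorem le_of_hasMeanLse_treeCov (ha : ∀ i, 0 ≤ a i) {A : ℝ} (hA : ∑ i ∈ Finset.range n, a i ≤ A)
    {p : ℝ} (hp : HasMeanLse (treeCov a β n κ) p) :
    p ≤ (∑ i ∈ Finset.range n, (κ i : ℝ)) * (Real.log 2 + β ^ 2 * A / 2) := by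
  classical
  have hA0 : 0 ≤ A := (Finset.sum_nonneg fun i _ => ha i).trans hA
  have h := hp.le_log_card_add
    (c := β ^ 2 * (∑ j ∈ Finset.range n, (κ j : ℝ)) * A) (by positivity) fun s => by
      refine le_trans ?_ (mul_le_mul_of_nonneg_left hA (by positivity))
      rw [Finset.mul_sum]
      refine Finset.sum_le_sum fun i _ => ?_
      have := mul_nonneg (show 0 ≤ β ^ 2 * (∑ j ∈ Finset.range n, (κ j : ℝ)) by positivity) (ha i)
      split_ifs
      · exact le_rfl
      · exact this
  have hcard : Real.log (Fintype.card (Leaf n κ)) =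
      (∑ i ∈ Finset.range n, (κ i : ℝ)) * Real.log 2 := by
    rw [Fintype.card_pi]
    simp only [Fintype.card_pi, Finset.prod_const, Finset.card_univ, Fintype.card_fin,
      Fintype.card_units_int]
    rw [Finset.prod_pow_eq_pow_sum, Nat.cast_pow, Real.log_pow, Finset.sum_range]
    push_cast
    rfl
  rw [hcard] at h
  linarith

/-- Levels without spins at the end of the tree can be dropped. -/
theorem bijective_restrict_leaf {n₀ : ℕ} (hn : n₀ ≤ n) (hκ : ∀ i, n₀ ≤ i → κ i = 0) :
    Function.Bijective fun (s : Leaf n κ) (i : Fin n₀) => s (Fin.castLE hn i) := by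
  constructor
  · intro s u h
    funext i
    by_cases hi : (i : ℕ) < n₀
    · exact congrFun h ⟨i, hi⟩
    · have : IsEmpty (Fin (κ i)) := by
        rw [hκ i (not_lt.1 hi)]
        infer_instance
      exact Subsingleton.elim _ _
  · intro s
    refine ⟨fun i => if hi : (i : ℕ) < n₀ then s ⟨i, hi⟩ else fun _ => 1, ?_⟩
    funext i
    simp

/-- Superadditivity compares trees with equally many levels; padding with empty levels achieves
this. -/
theorem hasMeanLse_treeCov_extend {n₀ : ℕ} (hn : n₀ ≤ n) (hκ : ∀ i, n₀ ≤ i → κ i = 0) {p : ℝ}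
    (hp : HasMeanLse (treeCov a β n₀ κ) p) : HasMeanLse (treeCov a β n κ) p := by
  classical
  convert hp.comp_equiv (Equiv.ofBijective _ (bijective_restrict_leaf hn hκ)) using 3 with s u
  have hsub : Finset.range n₀ ⊆ Finset.range n := by simpa using hn
  unfold treeCov
  rw [← Finset.sum_subset hsub (fun i _ hi => by
    rw [hκ i (by simpa using hi)]; simp)]
  rw [← Finset.sum_subset hsub (f := fun i => (κ i : ℝ)) (fun i _ hi => by
    rw [hκ i (by simpa using hi)]; simp)]
  refine Finset.sum_congr rfl fun i hi => ?_
  congr 2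
  rw [initialPath_eq_iff, initialPath_eq_iff, eq_iff_iff]
  refine ⟨fun h j hj => h (Fin.castLE hn j) hj, fun h j hj => ?_⟩
  exact h ⟨j, hj.trans_lt (Finset.mem_range.1 hi)⟩ hj

end Tree

end GREM

/-! ### The Hamiltonian as a Gaussian field with tree covariance. -/

namespace GREM

section Field

variable {n : ℕ}

open Classical in
/-- The coefficient of the variable of the edge `e` in `-β H(σ)`. -/
noncomputable def edgeCoeff (k : Fin n → ℕ) (β : ℝ) (σ : Config k) (e : Edge k) : ℝ :=
  if ancestor k σ e.1 = e.2 then β * √(size k : ℝ) else 0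

theorem sum_edgeCoeff_mul (k : Fin n → ℕ) (β : ℝ) (σ : Config k) (ω : Edge k → ℝ) :
    ∑ e, edgeCoeff k β σ e * ω e = -β * hamiltonian k ω σ := by
  classical
  have h : ∑ i, eps k ω σ i = ∑ i : {i // 0 < k i}, ω ⟨i, ancestor k σ i⟩ := by
    unfold eps
    rw [Finset.sum_dite, Finset.sum_const_zero, add_zero]
    refine Fintype.sum_equiv (Equiv.subtypeEquivRight (by simp)) _ _ fun i => rfl
  rw [Fintype.sum_sigma, hamiltonian, h, Finset.mul_sum, Finset.mul_sum]
  refine Finset.sum_congr rfl fun i _ => ?_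
  simp only [edgeCoeff, ite_mul, zero_mul, Finset.sum_ite_eq, Finset.mem_univ, if_true]
  ring

theorem lse_sum_edgeCoeff (k : Fin n → ℕ) (β : ℝ) (ω : Edge k → ℝ) :
    lse (fun σ => ∑ e, edgeCoeff k β σ e * ω e) = Real.log (partitionFunction k β ω) := by
  simp_rw [sum_edgeCoeff_mul]
  rfl

theorem isCenteredGaussian_field (k : Fin n → ℕ) (a : ℕ → ℝ) (β : ℝ) :
    IsCenteredGaussian ((disorder k a).map fun ω σ => ∑ e, edgeCoeff k β σ e * ω e)
      (fun σ τ => ∑ e, (a e.1).toNNReal * edgeCoeff k β σ e * edgeCoeff k β τ e) :=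
  IsCenteredGaussian.map_pi_gaussianReal (fun e : Edge k => (a e.1).toNNReal) (edgeCoeff k β)

theorem integrable_log_partitionFunction (k : Fin n → ℕ) (a : ℕ → ℝ) (β : ℝ) :
    Integrable (fun ω => Real.log (partitionFunction k β ω)) (disorder k a) := by
  simp_rw [← lse_sum_edgeCoeff]
  exact (isCenteredGaussian_field k a β).integrable_lse_self.comp_measurable
    (measurable_pi_lambda _ fun σ => by fun_prop)

theorem hasMeanLse_field (k : Fin n → ℕ) (a : ℕ → ℝ) (β : ℝ) :
    HasMeanLse (fun σ τ => ∑ e, (a e.1).toNNReal * edgeCoeff k β σ e * edgeCoeff k β τ e)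
      (∫ ω, Real.log (partitionFunction k β ω) ∂disorder k a) := by
  refine ⟨_, isCenteredGaussian_field k a β, ?_⟩
  rw [integral_map (measurable_pi_lambda _ fun σ => by fun_prop).aemeasurable
    continuous_lse.aestronglyMeasurable]
  simp_rw [lse_sum_edgeCoeff]

/-- Spin configurations as leaves of the tree. -/
def leafEquivConfig (n : ℕ) (κ : ℕ → ℕ) : Leaf n κ ≃ Config fun i : Fin n => κ i :=
  (Equiv.piCurry fun (i : Fin n) (_ : Fin (κ i)) => ℤˣ).symm.trans
    (Equiv.arrowCongr finSigmaFinEquiv (Equiv.refl _))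

theorem ancestor_leafEquivConfig {κ : ℕ → ℕ} (s : Leaf n κ) (i : Fin n)
    (j : {j : Fin n // j ≤ i}) :
    ancestor (fun i : Fin n => κ i) (leafEquivConfig n κ s) i j = s j := by
  funext m
  change (fun x : (i : Fin n) × Fin (κ i) => s x.1 x.2)
    (finSigmaFinEquiv.symm (finSigmaFinEquiv ⟨j, m⟩)) = s j m
  rw [Equiv.symm_apply_apply]

theorem ancestor_eq_iff {κ : ℕ → ℕ} (s u : Leaf n κ) (i : Fin n) :
    ancestor (fun i : Fin n => κ i) (leafEquivConfig n κ s) i =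
      ancestor (fun i : Fin n => κ i) (leafEquivConfig n κ u) i ↔
      initialPath i s = initialPath i u := by
  rw [initialPath_eq_iff, funext_iff]
  simp only [ancestor_leafEquivConfig, Subtype.forall, Fin.le_def]

/-- Two leaves share the edge of a nonempty level exactly when their initial paths agree there, and
each shared edge contributes `β² |k| a i`. -/
theorem hasMeanLse_treeCov_integral {a : ℕ → ℝ} (ha : ∀ i, 0 ≤ a i) (β : ℝ) (n : ℕ)
    (κ : ℕ → ℕ) :
    HasMeanLse (treeCov a β n κ) (∫ ω, Real.log (partitionFunction (fun i : Fin n => κ i) β ω)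
      ∂disorder (fun i : Fin n => κ i) a) := by
  classical
  convert (hasMeanLse_field (fun i : Fin n => κ i) a β).comp_equiv (leafEquivConfig n κ) using 1
  funext s u
  rw [Fintype.sum_sigma, treeCov, Finset.sum_range]
  have hsize : ((size fun i : Fin n => κ i : ℕ) : ℝ) = ∑ j ∈ Finset.range n, (κ j : ℝ) := by
    rw [size, Finset.sum_range]
    push_cast
    rfl
  simp_rw [ite_and]
  rw [← Finset.sum_filter, Finset.sum_subtype (p := fun i : Fin n => 0 < κ i) _ (by simp)]
  refine Finset.sum_congr rfl fun i _ => ?_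
  simp only [edgeCoeff, mul_ite, mul_zero, ite_mul, zero_mul, Finset.sum_ite_eq, Finset.mem_univ,
    if_true]
  rw [hsize, Real.coe_toNNReal _ (ha _)]
  have hsq := Real.mul_self_sqrt
    (show 0 ≤ ∑ j ∈ Finset.range n, (κ j : ℝ) by positivity)
  simp only [ancestor_eq_iff]
  split_ifs
  · linear_combination (-(a i * β ^ 2)) * hsq
  · rfl

end Field

/-! ### Level sizes and their asymptotics. -/

section Levels

variable {α : ℕ → ℝ}

theorem levelSize_eq_floor_mul (α : ℕ → ℝ) (N i : ℕ) :
    levelSize α N i = ⌊Real.log (α i) / Real.log 2 * N⌋₊ := by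
  rw [levelSize, mul_div_assoc, mul_comm]

theorem hasSum_log_div (hαsum : HasSum (fun i => Real.log (α i)) (Real.log 2)) :
    HasSum (fun i => Real.log (α i) / Real.log 2) 1 := by
  have := hαsum.div_const (Real.log 2)
  rwa [div_self (Real.log_pos one_lt_two).ne'] at this

theorem log_div_nonneg (hα : ∀ i, 1 < α i) (i : ℕ) : 0 ≤ Real.log (α i) / Real.log 2 :=
  div_nonneg (Real.log_nonneg (hα i).le) (Real.log_nonneg one_le_two)

theorem levelSize_add_le (hα : ∀ i, 1 < α i) (M N i : ℕ) :
    levelSize α M i + levelSize α N i ≤ levelSize α (M + N) i := by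
  have h := log_div_nonneg hα i
  simp_rw [levelSize_eq_floor_mul]
  rw [Nat.cast_add, mul_add]
  refine Nat.le_floor ?_
  rw [Nat.cast_add]
  exact add_le_add (Nat.floor_le (by positivity)) (Nat.floor_le (by positivity))

theorem levelSize_mono (hα : ∀ i, 1 < α i) {M N : ℕ} (h : M ≤ N) (i : ℕ) :
    levelSize α M i ≤ levelSize α N i := by
  have := log_div_nonneg hα i
  simp_rw [levelSize_eq_floor_mul]
  gcongr

/-- The summands `log α_i / log 2` tend to zero, so for fixed `N` the floors eventually vanish.
Without this bound the supremum in `numLevels` would be a default value. -/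
theorem bddAbove_levels (hαsum : HasSum (fun i => Real.log (α i)) (Real.log 2)) (N : ℕ) :
    BddAbove {n : ℕ | ∃ i, n = i + 1 ∧ 0 < levelSize α N i} := by
  have h : Tendsto (fun i => Real.log (α i) / Real.log 2 * N) atTop (𝓝 (0 * N)) :=
    (hasSum_log_div hαsum).summable.tendsto_atTop_zero.mul_const _
  rw [zero_mul] at h
  obtain ⟨m, hm⟩ := eventually_atTop.1 (h.eventually_lt_const one_pos)
  refine ⟨m, ?_⟩
  rintro _ ⟨i, rfl, hi⟩
  by_contra! hlt
  have := hm i (by omega)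
  rw [levelSize_eq_floor_mul, Nat.floor_pos] at hi
  linarith

theorem levelSize_eq_zero (hαsum : HasSum (fun i => Real.log (α i)) (Real.log 2)) {N i : ℕ}
    (h : numLevels α N ≤ i) : levelSize α N i = 0 := by
  by_contra hne
  have : i + 1 ≤ numLevels α N :=
    le_csSup (bddAbove_levels hαsum N) ⟨i, rfl, Nat.pos_of_ne_zero hne⟩
  omega

theorem numLevels_mono (hα : ∀ i, 1 < α i)
    (hαsum : HasSum (fun i => Real.log (α i)) (Real.log 2)) {M N : ℕ} (h : M ≤ N) :
    numLevels α M ≤ numLevels α N := by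
  by_contra! hlt
  have hne : {n : ℕ | ∃ i, n = i + 1 ∧ 0 < levelSize α M i}.Nonempty := by
    by_contra hne
    rw [Set.not_nonempty_iff_eq_empty] at hne
    simp [numLevels, hne] at hlt
  obtain ⟨i, hi, hpos⟩ := Nat.sSup_mem hne (bddAbove_levels hαsum M)
  have h0 := levelSize_eq_zero hαsum (N := N) (i := i) (by unfold numLevels at *; omega)
  have := levelSize_mono hα h i
  omega

theorem size_levels (α : ℕ → ℝ) (N : ℕ) :
    (size (levels α N) : ℝ) = ∑ i ∈ Finset.range (numLevels α N), (levelSize α N i : ℝ) := by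
  rw [size, Finset.sum_range]
  push_cast
  rfl

theorem size_levels_le (hα : ∀ i, 1 < α i)
    (hαsum : HasSum (fun i => Real.log (α i)) (Real.log 2)) (N : ℕ) :
    (size (levels α N) : ℝ) ≤ N := by
  rw [size_levels]
  calc ∑ i ∈ Finset.range (numLevels α N), (levelSize α N i : ℝ)
      ≤ ∑ i ∈ Finset.range (numLevels α N), Real.log (α i) / Real.log 2 * N := by
        refine Finset.sum_le_sum fun i _ => ?_
        rw [levelSize_eq_floor_mul]
        exact Nat.floor_le (mul_nonneg (log_div_nonneg hα i) N.cast_nonneg)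
    _ = (∑ i ∈ Finset.range (numLevels α N), Real.log (α i) / Real.log 2) * N := by
        rw [Finset.sum_mul]
    _ ≤ 1 * N := by
        gcongr
        exact sum_le_hasSum _ (fun i _ => log_div_nonneg hα i) (hasSum_log_div hαsum)
    _ = N := one_mul _

/-- Dominated convergence for series: `k_i(N) / N` tends to `log α_i / log 2` and is bounded by it.
-/
theorem tendsto_size_levels_div (hα : ∀ i, 1 < α i)
    (hαsum : HasSum (fun i => Real.log (α i)) (Real.log 2)) :
    Tendsto (fun N : ℕ => (size (levels α N) : ℝ) / N) atTop (𝓝 1) := by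
  have hs := hasSum_log_div hαsum
  have h : Tendsto (fun N : ℕ => ∑' i, (levelSize α N i : ℝ) / N) atTop
      (𝓝 (∑' i, Real.log (α i) / Real.log 2)) := by
    refine tendsto_tsum_of_dominated_convergence hs.summable (fun i => ?_)
      (Eventually.of_forall fun N i => ?_)
    · simp_rw [levelSize_eq_floor_mul]
      exact (tendsto_nat_floor_mul_div_atTop (log_div_nonneg hα i)).comp
        tendsto_natCast_atTop_atTop
    · rw [Real.norm_of_nonneg (by positivity), levelSize_eq_floor_mul]
      refine div_le_of_le_mul₀ N.cast_nonneg (log_div_nonneg hα i) ?_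
      exact Nat.floor_le (mul_nonneg (log_div_nonneg hα i) N.cast_nonneg)
  rw [hs.tsum_eq] at h
  refine h.congr fun N => ?_
  rw [tsum_eq_sum (s := Finset.range (numLevels α N)) fun i hi => by
    rw [levelSize_eq_zero hαsum (by simpa using hi)]; simp, size_levels, Finset.sum_div]

end Levels

/-! ### Subadditivity and lower bound for the free energy. -/

section FreeEnergy

variable {α a : ℕ → ℝ} {β : ℝ}

theorem hasMeanLse_neg_alphaN (ha : ∀ i, 0 ≤ a i) (α : ℕ → ℝ) (β : ℝ) (N : ℕ) :
    HasMeanLse (treeCov a β (numLevels α N) (levelSize α N)) (-alphaN α a β N) := by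
  rw [alphaN, neg_neg]
  exact hasMeanLse_treeCov_integral ha β _ _

theorem subadditive_alphaN (hα : ∀ i, 1 < α i)
    (hαsum : HasSum (fun i => Real.log (α i)) (Real.log 2)) (ha : ∀ i, 0 ≤ a i) (β : ℝ) :
    Subadditive (alphaN α a β) := by
  intro M N
  have hext : ∀ {K : ℕ}, K ≤ M + N →
      HasMeanLse (treeCov a β (numLevels α (M + N)) (levelSize α K)) (-alphaN α a β K) :=
    fun hK => hasMeanLse_treeCov_extend (numLevels_mono hα hαsum hK)
      (fun i hi => levelSize_eq_zero hαsum hi) (hasMeanLse_neg_alphaN ha α β _)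
  have := add_le_of_hasMeanLse_treeCov_of_le ha (levelSize_add_le hα M N)
    (hext (Nat.le_add_right M N)) (hext (Nat.le_add_left N M)) (hext le_rfl)
  linarith

theorem neg_le_alphaN_div (hα : ∀ i, 1 < α i)
    (hαsum : HasSum (fun i => Real.log (α i)) (Real.log 2)) (ha : ∀ i, 0 ≤ a i)
    (hasum : HasSum a 1) (N : ℕ) :
    -(Real.log 2 + β ^ 2 / 2) ≤ alphaN α a β N / N := by
  have hc : 0 ≤ Real.log 2 + β ^ 2 / 2 :=
    add_nonneg (Real.log_nonneg one_le_two) (by positivity)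
  rcases N.eq_zero_or_pos with rfl | hN
  · rw [Nat.cast_zero, div_zero]
    exact neg_nonpos.2 hc
  have h := le_of_hasMeanLse_treeCov ha (sum_le_hasSum _ (fun i _ => ha i) hasum)
    (hasMeanLse_neg_alphaN ha α β N)
  rw [← size_levels, mul_one] at h
  have h2 := mul_le_mul_of_nonneg_right (size_levels_le hα hαsum N) hc
  rw [le_div_iff₀ (by exact_mod_cast hN)]
  linarith

end FreeEnergy

end GREM

/-- Existence of the thermodynamic limit of the quenched free energy density of the GREM with
infinitely many levels. The limit `L` is a real number, i.e. finite, and it is the infimum of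
`α_N(β) / (β N)` over `N ≥ 1`; the expectations involved are genuine (`log Z_N` is integrable). -/
theorem mainTheorem2 (α a : ℕ → ℝ)
    (hα : ∀ i, 1 < α i) (hαsum : HasSum (fun i => Real.log (α i)) (Real.log 2))
    (ha : ∀ i, 0 < a i) (hasum : HasSum a 1)
    (β : ℝ) (hβ : 0 < β) :
    (∀ N : ℕ, Integrable (GREM.logZ α β N) (GREM.disorder (GREM.levels α N) a)) ∧
    ∃ L : ℝ,
      Tendsto (fun N : ℕ => GREM.freeEnergy α a β N) atTop (𝓝 L) ∧
      IsGLB {x : ℝ | ∃ N : ℕ, 0 < N ∧ x = GREM.alphaN α a β N / (β * N)} L := by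
  refine ⟨fun N => GREM.integrable_log_partitionFunction _ a β, ?_⟩
  have hsub := GREM.subadditive_alphaN hα hαsum (fun i => (ha i).le) β
  have hbdd : BddBelow (Set.range fun N : ℕ => GREM.alphaN α a β N / N) := by
    refine ⟨-(Real.log 2 + β ^ 2 / 2), ?_⟩
    rintro _ ⟨N, rfl⟩
    exact GREM.neg_le_alphaN_div hα hαsum (fun i => (ha i).le) hasum N
  -- Fekete's lemma.
  have hlim := hsub.tendsto_lim hbdd
  refine ⟨hsub.lim / β, ?_, ?_⟩
  · have h := (hlim.div (GREM.tendsto_size_levels_div hα hαsum) one_ne_zero).div_const β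
    rw [div_one] at h
    refine h.congr' ?_
    filter_upwards [eventually_gt_atTop 0] with N hN
    have hN' : (N : ℝ) ≠ 0 := by exact_mod_cast hN.ne'
    simp only [Pi.div_apply]
    rw [div_div_div_cancel_right₀ hN', GREM.freeEnergy, GREM.alphaN, div_div, mul_comm β]
    ring
  · have hle : ∀ N : ℕ, GREM.alphaN α a β N / (β * N) = GREM.alphaN α a β N / N / β := by
      intro N
      rw [div_div, mul_comm β]
    constructor
    · rintro _ ⟨N, hN, rfl⟩
      rw [hle]
      gcongr
      exact hsub.lim_le_div hbdd hN.ne'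
    -- A lower bound of all the terms also bounds their limit.
    · intro b hb
      refine ge_of_tendsto (hlim.div_const β) ?_
      filter_upwards [eventually_gt_atTop 0] with N hN
      exact (hb ⟨N, hN, rfl⟩).trans_eq (hle N)
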